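/- **Theorem.** Let $X$ be a metric space with a distinguished point $0$. For a real Banach space $E$, let $Lip_0(X;E)$ be the set of all Lipschitz maps $T:X\to E$ with $T(0)=0$, and let $Lip_{0\mathcal W}(X;E)$ be the subset of Lipschitz weakly compact maps, that is, of those $T\in Lip_0(X;E)$ whose Lipschitz image $$\left\{\frac{T(x)-T(y)}{d(x,y)} : x,y\in X,\ x\neq y\right\}$$ is relatively weakly compact in $E$ (its closure in the weak topology of $E$ is weakly compact). The following properties are equivalent. 1. The metric space $X$ is finite. 2. For every real Banach space $E$, $Lip_{0\mathcal W}(X;E)=Lip_0(X;E)$. -/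

import Mathlib

universe u v

/-- `Lip₀(X; E)`: the Lipschitz maps from the metric space `X` with distinguished point `x₀`
to the normed space `E` that vanish at `x₀`. -/
def LipZero {X E : Type*} [MetricSpace X] [NormedAddCommGroup E] (x₀ : X) : Set (X → E) :=
  {T | (∃ K : NNReal, LipschitzWith K T) ∧ T x₀ = 0}

/-- The Lipschitz image of `T : X → E`: the set of all difference quotients
`(T x - T y) / d(x, y)` with `x ≠ y`. -/
def lipschitzImage {X E : Type*} [MetricSpace X] [NormedAddCommGroup E] [NormedSpace ℝ E]
    (T : X → E) : Set E :=
  {e | ∃ x y : X, x ≠ y ∧ e = (dist x y)⁻¹ • (T x - T y)}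

/-- A subset of a real normed space is relatively weakly compact if its closure in the weak
topology is weakly compact. -/
def IsRelativelyWeaklyCompact {E : Type*} [NormedAddCommGroup E] [NormedSpace ℝ E]
    (S : Set E) : Prop :=
  IsCompact (closure (toWeakSpace ℝ E '' S))

/-- The Lipschitz weakly compact maps in `Lip₀(X; E)`: those whose Lipschitz image is
relatively weakly compact. -/
def LipZeroWeaklyCompact {X E : Type*} [MetricSpace X] [NormedAddCommGroup E] [NormedSpace ℝ E]
    (x₀ : X) : Set (X → E) :=
  {T | T ∈ LipZero x₀ ∧ IsRelativelyWeaklyCompact (lipschitzImage T)}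

/-!
If `X` is finite, every Lipschitz image is finite, hence weakly compact.

If `X` is infinite, it contains points `xᵢ` (`i : ℕ`) with disjoint balls `B(xᵢ, rᵢ)`, together with
points `yᵢ` lying in none of these balls and satisfying `d(xᵢ, yᵢ) < 4 rᵢ`
(`exists_balls_with_nearby_points`). Here `rᵢ` is half the distance from `xᵢ` to the other members
of a relatively discrete sequence, `yᵢ` is a member of that sequence nearly realizing this distance,
and a subsequence is chosen so that no `yᵢ` is a centre (`exists_seq_forall_apply_ne`).
The map `z ↦ ∑ᵢ max (0, rᵢ - d(z, xᵢ)) • eᵢ` into `ℓ¹` is then Lipschitz, and its difference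
quotient at `(xᵢ, yᵢ)` is `aᵢ • eᵢ` with `aᵢ ≥ 1/4`. Such a sequence has no weak cluster point in
`ℓ¹`: all coordinates of a cluster point would vanish, whereas the sum of its coordinates, a
continuous functional, would be at least `1/4` (`not_isRelativelyWeaklyCompact_of_single_mem`).
-/

open Filter Topology

/-! ### Weak compactness -/

theorem Set.Finite.isRelativelyWeaklyCompact {E : Type*} [NormedAddCommGroup E] [NormedSpace ℝ E]
    {S : Set E} (hS : S.Finite) : IsRelativelyWeaklyCompact S :=
  (hS.image _).isCompact.closure

/-- Cluster points for the weak topology pass to closed conditions on a continuous functional. -/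
theorem apply_mem_of_mapClusterPt_toWeakSpace {ι E : Type*} [NormedAddCommGroup E]
    [NormedSpace ℝ E] {l : Filter ι} {f : ι → E} {q : E}
    (hq : MapClusterPt (toWeakSpace ℝ E q) l fun i => toWeakSpace ℝ E (f i))
    (φ : E →L[ℝ] ℝ) {C : Set ℝ} (hC : IsClosed C) (hf : ∀ᶠ i in l, φ (f i) ∈ C) : φ q ∈ C := by
  have hφ : Continuous fun w : WeakSpace ℝ E => φ ((toWeakSpace ℝ E).symm w) :=
    WeakBilin.eval_continuous (topDualPairing ℝ E).flip φ
  by_contra h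
  have hmem : {w : WeakSpace ℝ E | φ ((toWeakSpace ℝ E).symm w) ∈ Cᶜ} ∈ 𝓝 (toWeakSpace ℝ E q) :=
    (hC.isOpen_compl.preimage hφ).mem_nhds (by simpa using h)
  obtain ⟨i, hi, hi'⟩ := ((hq.frequently hmem).and_eventually hf).exists
  exact hi (by simpa using hi')

open Classical in
theorem not_isRelativelyWeaklyCompact_of_single_mem {ι : Type*} [Infinite ι]
    {S : Set (lp (fun _ : ι => ℝ) 1)} {δ : ℝ} (hδ : 0 < δ) (a : ι → ℝ) (ha : ∀ i, δ ≤ a i)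
    (hS : ∀ i, lp.single 1 i (a i) ∈ S) : ¬ IsRelativelyWeaklyCompact S := by
  intro h
  obtain ⟨w, -, hw⟩ := h.exists_mapClusterPt (f := (cofinite : Filter ι))
    (u := fun i => toWeakSpace ℝ (lp (fun _ : ι => ℝ) 1) (lp.single 1 i (a i)))
    (tendsto_principal.2 <| Eventually.of_forall fun i =>
      subset_closure (Set.mem_image_of_mem _ (hS i)))
  obtain ⟨q, rfl⟩ := (toWeakSpace ℝ (lp (fun _ : ι => ℝ) 1)).surjective w
  have hcoord : ∀ k, q k = 0 := fun k =>
    apply_mem_of_mapClusterPt_toWeakSpace hw (lp.evalCLM ℝ (fun _ : ι => ℝ) 1 k)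
      (C := {0}) isClosed_singleton <| by
        filter_upwards [(Set.finite_singleton k).compl_mem_cofinite] with i hi
        exact lp.single_apply_ne (E := fun _ : ι => ℝ) 1 i (a i) (Ne.symm hi)
  have hq : q = 0 := lp.ext (funext hcoord)
  have hsum : lp.tsumCLM ℝ ι ℝ q ∈ Set.Ici δ :=
    apply_mem_of_mapClusterPt_toWeakSpace hw (lp.tsumCLM ℝ ι ℝ) isClosed_Ici <|
      Eventually.of_forall fun i => by
        have : lp.tsumCLM ℝ ι ℝ (lp.single 1 i (a i)) = a i := by
          rw [lp.tsumCLM_apply, lp.coeFn_single, tsum_pi_single]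
        simpa [this] using ha i
  rw [hq, map_zero] at hsum
  exact absurd hsum (not_le.2 hδ)

/-! ### Disjoint balls in an infinite metric space -/

theorem exists_seq_forall_apply_ne {α : Type*} [Infinite α] (m : α → α) (hm : ∀ a, m a ≠ a) :
    ∃ s : ℕ → α, Function.Injective s ∧ ∀ i j, m (s i) ≠ s j := by
  classical
  by_cases h : ∃ b, (m ⁻¹' {b}).Infinite
  · obtain ⟨b, hb⟩ := h
    have := hb.to_subtype
    have key : ∀ i, m (Infinite.natEmbedding (m ⁻¹' {b}) i) = b := fun i =>
      (Infinite.natEmbedding (m ⁻¹' {b}) i).2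
    refine ⟨fun i => Infinite.natEmbedding (m ⁻¹' {b}) i,
      Subtype.val_injective.comp (Infinite.natEmbedding _).injective, fun i j hij => ?_⟩
    rw [key] at hij
    exact hm b (by rw [hij, key, ← hij])
  · -- All fibres of `m` are finite, so the sequence can be chosen greedily.
    simp only [not_exists, Set.not_infinite] at h
    obtain ⟨s, -, hs⟩ := exists_seq_of_forall_finset_exists (fun _ : α => True)
      (fun a b => b ≠ a ∧ b ≠ m a ∧ m b ≠ a) fun t _ => by
        obtain ⟨b, hb⟩ := Infinite.exists_notMem_finset
          (t ∪ t.image m ∪ t.biUnion fun a => (h a).toFinset)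
        simp only [Finset.mem_union, Finset.mem_image, Finset.mem_biUnion, not_or, not_exists,
          not_and, Set.Finite.mem_toFinset, Set.mem_preimage, Set.mem_singleton_iff] at hb
        exact ⟨b, trivial, fun a ha =>
          ⟨fun e => hb.1.1 (e ▸ ha), fun e => hb.1.2 a ha e.symm, hb.2 a ha⟩⟩
    refine ⟨s, fun i j hij => ?_, fun i j hij => ?_⟩
    · rcases lt_trichotomy i j with hlt | rfl | hlt
      · exact absurd hij.symm (hs i j hlt).1
      · rfl
      · exact absurd hij (hs j i hlt).1
    · rcases lt_trichotomy i j with hlt | rfl | hlt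
      · exact (hs i j hlt).2.1 hij.symm
      · exact hm _ hij
      · exact (hs j i hlt).2.2 hij

theorem exists_seq_infDist_pos (X : Type*) [MetricSpace X] [Infinite X] :
    ∃ p : ℕ → X, ∀ n, 0 < Metric.infDist (p n) (p '' {n}ᶜ) := by
  obtain ⟨U, hU, hUo, hUd⟩ := exists_seq_infinite_isOpen_pairwise_disjoint X
  choose p hp using fun n => (hU n).nonempty
  refine ⟨p, fun n => ?_⟩
  obtain ⟨ε, hε, hεU⟩ := Metric.isOpen_iff.1 (hUo n) (p n) (hp n)
  have hne : (p '' {n}ᶜ).Nonempty := ⟨p (n + 1), n + 1, by simp, rfl⟩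
  refine hε.trans_le ((Metric.le_infDist hne).2 ?_)
  rintro _ ⟨k, hk, rfl⟩
  by_contra! hlt
  exact Set.disjoint_left.1 (hUd (Ne.symm hk)) (hεU (Metric.mem_ball'.2 hlt)) (hp k)

theorem exists_balls_with_nearby_points (X : Type*) [MetricSpace X] [Infinite X] :
    ∃ (x y : ℕ → X) (r : ℕ → ℝ), (∀ i, 0 < r i) ∧
      (Pairwise fun i j => r i + r j ≤ dist (x i) (x j)) ∧
      (∀ i j, r i ≤ dist (y j) (x i)) ∧ ∀ i, dist (x i) (y i) < 4 * r i := by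
  obtain ⟨p, hp⟩ := exists_seq_infDist_pos X
  have hne : ∀ n, (p '' {n}ᶜ).Nonempty := fun n => ⟨p (n + 1), n + 1, by simp, rfl⟩
  have hle : ∀ n k, n ≠ k → Metric.infDist (p n) (p '' {n}ᶜ) ≤ dist (p n) (p k) := fun n k h =>
    Metric.infDist_le_dist_of_mem ⟨k, h.symm, rfl⟩
  have hnear : ∀ n, ∃ k, k ≠ n ∧ dist (p n) (p k) < 2 * Metric.infDist (p n) (p '' {n}ᶜ) :=
    fun n => by
      obtain ⟨_, ⟨k, hk, rfl⟩, hlt⟩ := (Metric.infDist_lt_iff (hne n)).1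
        (show Metric.infDist (p n) (p '' {n}ᶜ) < 2 * Metric.infDist (p n) (p '' {n}ᶜ) by
          linarith [hp n])
      exact ⟨k, hk, hlt⟩
  choose m hm hmd using hnear
  obtain ⟨s, hs, hsm⟩ := exists_seq_forall_apply_ne m hm
  refine ⟨p ∘ s, p ∘ m ∘ s, fun i => Metric.infDist (p (s i)) (p '' {s i}ᶜ) / 2,
    fun i => half_pos (hp _), fun i j hij => ?_, fun i j => ?_, fun i => ?_⟩
  · have h1 := hle (s i) (s j) (hs.ne hij)
    have h2 := hle (s j) (s i) (hs.ne hij.symm)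
    rw [dist_comm] at h2
    simp only [Function.comp_apply]
    linarith
  · have h1 := hle (s i) (m (s j)) (hsm j i).symm
    have h2 := hp (s i)
    rw [dist_comm] at h1
    simp only [Function.comp_apply]
    linarith
  · have h1 := hmd (s i)
    simp only [Function.comp_apply]
    linarith

/-! ### The sum of disjoint bumps as a map into `ℓ¹` -/

open Classical in
/-- The map `z ↦ ∑ᵢ max (0, rᵢ - d(z, xᵢ)) • eᵢ` into `ℓ¹(ι)`. The balls `B(xᵢ, rᵢ)` are meant to
be disjoint, so the sum has at most one nonzero term; the definition selects that term directly. -/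
noncomputable def bumpMap {ι X : Type*} [MetricSpace X] (x : ι → X) (r : ι → ℝ) (z : X) :
    lp (fun _ : ι => ℝ) 1 :=
  if h : ∃ i, dist z (x i) < r i then lp.single 1 h.choose (r h.choose - dist z (x h.choose)) else 0

section bumpMap

variable {ι X : Type*} [MetricSpace X] {x : ι → X} {r : ι → ℝ}

theorem bumpMap_of_forall_le {z : X} (h : ∀ i, r i ≤ dist z (x i)) : bumpMap x r z = 0 :=
  dif_neg fun ⟨i, hi⟩ => (h i).not_gt hi

theorem eq_of_dist_lt_of_dist_lt (hd : Pairwise fun i j => r i + r j ≤ dist (x i) (x j)) {z : X}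
    {i j : ι} (hi : dist z (x i) < r i) (hj : dist z (x j) < r j) : i = j := by
  by_contra hij
  have h1 := hd hij
  have h2 := dist_triangle_left (x i) (x j) z
  linarith

open Classical in
theorem bumpMap_of_lt (hd : Pairwise fun i j => r i + r j ≤ dist (x i) (x j)) {z : X} {i : ι}
    (hi : dist z (x i) < r i) : bumpMap x r z = lp.single 1 i (r i - dist z (x i)) := by
  have h : ∃ i, dist z (x i) < r i := ⟨i, hi⟩
  rw [bumpMap, dif_pos h, eq_of_dist_lt_of_dist_lt hd h.choose_spec hi]

theorem norm_bumpMap_le_dist {z w : X} {i : ι}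
    (hd : Pairwise fun i j => r i + r j ≤ dist (x i) (x j))
    (hz : dist z (x i) < r i) (hw : r i ≤ dist w (x i)) : ‖bumpMap x r z‖ ≤ dist z w := by
  classical
  rw [bumpMap_of_lt hd hz, lp.norm_single one_pos, Real.norm_of_nonneg (sub_nonneg.2 hz.le)]
  linarith [dist_triangle_left w (x i) z]

theorem lipschitzWith_bumpMap (hd : Pairwise fun i j => r i + r j ≤ dist (x i) (x j)) :
    LipschitzWith 2 (bumpMap x r) := by
  classical
  refine LipschitzWith.of_dist_le_mul fun z w => ?_
  have h0 : (0 : ℝ) ≤ dist z w := dist_nonneg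
  rw [dist_eq_norm, NNReal.coe_ofNat]
  by_cases hz : ∃ i, dist z (x i) < r i
  · obtain ⟨i, hi⟩ := hz
    by_cases hw : dist w (x i) < r i
    · rw [bumpMap_of_lt hd hi, bumpMap_of_lt hd hw, ← lp.single_sub, lp.norm_single one_pos,
        sub_sub_sub_cancel_left, Real.norm_eq_abs]
      have := abs_dist_sub_le w z (x i)
      rw [dist_comm w z] at this
      linarith
    · have h1 := norm_bumpMap_le_dist hd hi (not_lt.1 hw)
      by_cases hw' : ∃ j, dist w (x j) < r j
      · obtain ⟨j, hj⟩ := hw'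
        have hzj : r j ≤ dist z (x j) := by
          by_contra! hlt
          exact hw (eq_of_dist_lt_of_dist_lt hd hi hlt ▸ hj)
        have h2 := norm_bumpMap_le_dist hd hj hzj
        rw [dist_comm] at h2
        linarith [norm_sub_le (bumpMap x r z) (bumpMap x r w)]
      · push Not at hw'
        rw [bumpMap_of_forall_le hw', sub_zero]
        linarith
  · push Not at hz
    rw [bumpMap_of_forall_le hz, zero_sub, norm_neg]
    by_cases hw : ∃ j, dist w (x j) < r j
    · obtain ⟨j, hj⟩ := hw
      have h2 := norm_bumpMap_le_dist hd hj (hz j)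
      rw [dist_comm] at h2
      linarith
    · push Not at hw
      rw [bumpMap_of_forall_le hw, norm_zero]
      linarith

end bumpMap

/-! ### The equivalence -/

theorem finite_lipschitzImage {X E : Type*} [MetricSpace X] [Finite X] [NormedAddCommGroup E]
    [NormedSpace ℝ E] (T : X → E) : (lipschitzImage T).Finite := by
  refine (Set.finite_range fun p : X × X => (dist p.1 p.2)⁻¹ • (T p.1 - T p.2)).subset ?_
  rintro _ ⟨x, y, -, rfl⟩
  exact ⟨(x, y), rfl⟩

/-- The index type is arbitrary so that `ℓ¹` may be taken in any universe. -/
theorem exists_lipZero_not_weaklyCompact {X : Type*} [MetricSpace X] [Infinite X] (x₀ : X)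
    {ι : Type*} (e : ι ≃ ℕ) :
    ∃ T : X → lp (fun _ : ι => ℝ) 1,
      T ∈ LipZero x₀ ∧ ¬ IsRelativelyWeaklyCompact (lipschitzImage T) := by
  classical
  have : Infinite ι := e.infinite_iff.2 inferInstance
  obtain ⟨x, y, r, hr, hd, hy, hxy⟩ := exists_balls_with_nearby_points X
  have hd' : Pairwise fun i j => (r ∘ e) i + (r ∘ e) j ≤ dist ((x ∘ e) i) ((x ∘ e) j) :=
    fun i j hij => hd (e.injective.ne hij)
  refine ⟨fun z => bumpMap (x ∘ e) (r ∘ e) z - bumpMap (x ∘ e) (r ∘ e) x₀,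
    ⟨⟨2, LipschitzWith.of_dist_le_mul fun z w => ?_⟩, sub_self _⟩,
    not_isRelativelyWeaklyCompact_of_single_mem (δ := 1 / 4) (by norm_num)
      (fun i => (dist (x (e i)) (y (e i)))⁻¹ * r (e i)) (fun i => ?_) fun i => ?_⟩
  · rw [dist_sub_right]
    exact (lipschitzWith_bumpMap hd').dist_le_mul z w
  · have hpos : 0 < dist (x (e i)) (y (e i)) := by
      rw [dist_comm]
      exact (hr _).trans_le (hy _ _)
    rw [inv_mul_eq_div, div_le_div_iff₀ (by norm_num) hpos]
    linarith [hxy (e i)]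
  · refine ⟨x (e i), y (e i), fun h => ?_, ?_⟩
    · have h1 := hy (e i) (e i)
      rw [← h, dist_self] at h1
      exact h1.not_gt (hr _)
    · have h1 : dist (x (e i)) ((x ∘ e) i) < (r ∘ e) i := by simpa using hr (e i)
      rw [sub_sub_sub_cancel_right, bumpMap_of_lt hd' h1,
        bumpMap_of_forall_le (x := x ∘ e) (r := r ∘ e) (z := y (e i)) fun j => hy (e j) (e i), sub_zero, ← lp.single_smul]
      simp

theorem theorem2p8 {X : Type u} [MetricSpace X] (x₀ : X) :
    Finite X ↔
      ∀ (E : Type v) [NormedAddCommGroup E] [NormedSpace ℝ E] [CompleteSpace E],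
        (LipZeroWeaklyCompact x₀ : Set (X → E)) = LipZero x₀ := by
  refine ⟨fun _ E _ _ _ => ?_, fun h => ?_⟩
  · exact Set.Subset.antisymm (fun T hT => hT.1) fun T hT =>
      ⟨hT, (finite_lipschitzImage T).isRelativelyWeaklyCompact⟩
  · by_contra hX
    rw [not_finite_iff_infinite] at hX
    obtain ⟨T, hT, hT'⟩ := exists_lipZero_not_weaklyCompact x₀ (Equiv.ulift.{v} : ULift ℕ ≃ ℕ)
    rw [← h (lp (fun _ : ULift.{v} ℕ => ℝ) 1)] at hT
    exact hT' hT.2
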